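/- Let $p\in(0,1)$ and let $\mu_p=p\,\delta_{1}+(1-p)\,\delta_{-1}$ on $\{-1,1\}$. Write $\mathbb{E}$, $\mathrm{Var}$ and $\|\cdot\|_1$ for the expectation, the variance and the $L^1$-norm with respect to the product measure $\mu_p^{\otimes n}$ on $\{-1,1\}^n$. For $f:\{-1,1\}^n\to\mathbb{R}$ and $1\le j\le n$ put $$D_jf(x)=\frac{f(x)-f(x^{\oplus j})}{2},\qquad |\nabla f|(x)=\Big(\sum_{j=1}^n|D_jf(x)|^2\Big)^{1/2},\qquad \mathrm{Inf}_j(f)=\|f-\mathbb{E}_{x_j\sim\mu_p}f\|_1,$$ where $x^{\oplus j}$ is $x$ with its $j$-th coordinate multiplied by $-1$, and $\mathbb{E}_{x_j\sim\mu_p}f$ is obtained from $f$ by averaging over the $j$-th coordinate alone, with respect to $\mu_p$. Then there is a constant $C_p>0$, depending only on $p$, such that for all $n\ge 1$ and all Boolean functions $f:\{-1,1\}^n\to\{-1,1\}$, $$\mathbb{E}|\nabla f|\;\ge\; C_p\,\mathrm{Var}(f)\,\sqrt{\log\Big(1+\frac{e}{\sum_{j=1}^{n}\mathrm{Inf}_j(f)^2}\Big)}.$$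 Here $\log$ is the natural logarithm, and for constant $f$ (the only case in which the sum of squared influences vanishes) the right-hand side is read as $0$. -/

import Mathlib

open MeasureTheory ProbabilityTheory

noncomputable section

namespace BiasedCube

/-- The discrete hypercube `{-1, 1}ⁿ`. The two-point set `{-1, 1}` is the group `ℤˣ` of units of
the integers, whose only elements are `1` and `-1`. -/
abbrev Cube (n : ℕ) : Type := Fin n → ℤˣ

/-- Points of `{-1, 1}` are measurable, so every function on the cube is measurable. -/
instance instMeasurableSingletonClassSign : MeasurableSingletonClass ℤˣ where
  measurableSet_singleton a := by
    refine ⟨{(a : ℤ)}, measurableSet_singleton _, ?_⟩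
    ext b
    simp [Units.ext_iff]

/-- The biased measure `μ_p = p δ₁ + (1 - p) δ₋₁` on `{-1, 1}`. -/
def biasedMeasure (p : ℝ) : Measure ℤˣ :=
  ENNReal.ofReal p • Measure.dirac 1 + ENNReal.ofReal (1 - p) • Measure.dirac (-1)

instance instIsFiniteMeasureBiased (p : ℝ) : IsFiniteMeasure (biasedMeasure p) := by
  have h1 := (Measure.dirac (1 : ℤˣ)).smul_finite (ENNReal.ofReal_ne_top (r := p))
  have h2 := (Measure.dirac (-1 : ℤˣ)).smul_finite (ENNReal.ofReal_ne_top (r := 1 - p))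
  unfold biasedMeasure
  infer_instance

/-- The product measure `μ_p^{⊗ n}` on `{-1, 1}ⁿ`. -/
def cubeMeasure (p : ℝ) (n : ℕ) : Measure (Cube n) :=
  Measure.pi fun _ => biasedMeasure p

/-- The point obtained from `x` by flipping the `j`-th variable. -/
def flip {n : ℕ} (x : Cube n) (j : Fin n) : Cube n :=
  Function.update x j (-(x j))

/-- The discrete derivative `D_j f (x) = (f(x) - f(x with the j-th variable flipped)) / 2`. -/
def discreteDeriv {n : ℕ} (j : Fin n) (f : Cube n → ℝ) (x : Cube n) : ℝ :=
  (f x - f (flip x j)) / 2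

/-- The length of the discrete gradient, `|∇f|(x) = (∑_j |D_j f(x)|²)^{1/2}`. -/
def gradNorm {n : ℕ} (f : Cube n → ℝ) (x : Cube n) : ℝ :=
  Real.sqrt (∑ j, |discreteDeriv j f x| ^ 2)

/-- The partial expectation `𝔼_{x_j ∼ μ_p} f`, a function on the cube that does not depend on the
`j`-th variable. -/
def partialExp (p : ℝ) {n : ℕ} (j : Fin n) (f : Cube n → ℝ) (x : Cube n) : ℝ :=
  ∫ y, f (Function.update x j y) ∂(biasedMeasure p)

/-- The `L¹` influence `Inf_j(f) = ‖f - 𝔼_{x_j ∼ μ_p} f‖₁`, the norm being that of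
`L¹(μ_p^{⊗ n})`. -/
def influence (p : ℝ) {n : ℕ} (j : Fin n) (f : Cube n → ℝ) : ℝ :=
  ∫ x, |f x - partialExp p j f x| ∂(cubeMeasure p n)

end BiasedCube

end

/-! The proof is a noise-semigroup argument. Let `T_ρ` keep each coordinate with probability `ρ` and
resample it otherwise, let `E_j` resample the `j`-th coordinate alone, and put `φ(ρ) = 𝔼[f T_ρ f]`.
Then `ρ φ'(ρ)` is the Dirichlet form of `T_√ρ f`, which is bounded in two ways.

From above: it equals `∑_j 𝔼[(f - E_j f)(T_ρ f - E_j T_ρ f)]`. Since `f² = 1`, the reverse Poincaré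
inequality `sum_sub_noise_resample_sq_le` bounds the second gradient pointwise by a multiple of `(1
- ρ)^{-1/2}`, so Cauchy–Schwarz leaves `𝔼|∇f| / √(1 - ρ)`. This is integrable at `ρ = 1`: over `[1 -
t, 1]`, `φ` drops by at most a multiple of `√t 𝔼|∇f|`.

From below: let `W` be the sum of squared influences and `L = log(1 + e/W)`. While `T_√ρ f` keeps
half of the variance of `f`, its energy is at least a multiple of `Var(f)(1 + L)`
(`mul_one_add_log_le_energy`). This is the Falik–Samorodnitsky method: an entropy–energy inequality,
tensorized from one coordinate, gives a Nash inequality, which is applied to martingale differences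
whose `L¹` norms are at most the influences.

With `t` of order `1/(1 + L)`, `φ` must drop by a multiple of `Var(f)`; comparing the two bounds
gives the theorem (`mul_sqrt_le_of_deriv_bounds`). Only the one-coordinate inequality
`biasedWeight_variance_sq_le` and the comparison of gradients are specific to the two-point space.
-/

namespace BiasedCube

set_option linter.unusedSectionVars false

/-! ### Noise operators on a finite product space -/

section Noise

variable {α : Type*} [Fintype α] [DecidableEq α] {n : ℕ}

/-- The transition kernel keeping the `j`-th coordinate with probability `r j` and otherwise
resampling it from the weight `w`. -/
noncomputable def noiseKernel (w : α → ℝ) (r : Fin n → ℝ) (x y : Fin n → α) : ℝ :=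
  ∏ j, (r j * (if x j = y j then 1 else 0) + (1 - r j) * w (y j))

/-- The Markov operator of `noiseKernel`. -/
noncomputable def noise (w : α → ℝ) (r : Fin n → ℝ) (f : (Fin n → α) → ℝ) (x : Fin n → α) : ℝ :=
  ∑ y, noiseKernel w r x y * f y

/-- The expectation with respect to the product of the weights `w`. -/
noncomputable def mean (w : α → ℝ) (f : (Fin n → α) → ℝ) : ℝ :=
  ∑ y, (∏ j, w (y j)) * f y

theorem sum_prod_apply (F : Fin n → α → ℝ) :
    ∑ y : Fin n → α, ∏ j, F j (y j) = ∏ j, ∑ b, F j b := by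
  rw [Finset.prod_univ_sum, Fintype.piFinset_univ]

variable {w : α → ℝ}

theorem noise_zero (f : (Fin n → α) → ℝ) (x : Fin n → α) : noise w 0 f x = mean w f := by
  simp [noise, mean, noiseKernel]

theorem noise_one (f : (Fin n → α) → ℝ) : noise w 1 f = f := by
  funext x
  have h : ∀ y, noiseKernel w 1 x y = if x = y then 1 else 0 := by
    intro y
    simp only [noiseKernel, Pi.one_apply, one_mul, sub_self, zero_mul, add_zero]
    rw [Finset.prod_ite_zero]
    simp [funext_iff]
  simp [noise, h]

theorem noise_add (r : Fin n → ℝ) (f g : (Fin n → α) → ℝ) :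
    noise w r (f + g) = noise w r f + noise w r g := by
  funext x; simp [noise, mul_add, Finset.sum_add_distrib]

theorem noise_sub (r : Fin n → ℝ) (f g : (Fin n → α) → ℝ) :
    noise w r (f - g) = noise w r f - noise w r g := by
  funext x; simp [noise, mul_sub, Finset.sum_sub_distrib]

theorem noise_smul (r : Fin n → ℝ) (c : ℝ) (f : (Fin n → α) → ℝ) :
    noise w r (c • f) = c • noise w r f := by
  funext x; simp [noise, Finset.mul_sum, mul_left_comm]

theorem sum_noiseKernel (hw1 : ∑ b, w b = 1) (r : Fin n → ℝ) (x : Fin n → α) :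
    ∑ y, noiseKernel w r x y = 1 := by
  simp only [noiseKernel]
  rw [sum_prod_apply fun j b => r j * (if x j = b then 1 else 0) + (1 - r j) * w b]
  simp [Finset.sum_add_distrib, ← Finset.mul_sum, hw1]

theorem noise_const (hw1 : ∑ b, w b = 1) (r : Fin n → ℝ) (c : ℝ) :
    noise w r (fun _ => c) = fun _ => c := by
  funext x
  simp [noise, ← Finset.sum_mul, sum_noiseKernel hw1]

theorem noise_noise (hw1 : ∑ b, w b = 1) (r s : Fin n → ℝ) (f : (Fin n → α) → ℝ) :
    noise w r (noise w s f) = noise w (r * s) f := by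
  funext x
  have h : ∀ z, ∑ y, noiseKernel w r x y * noiseKernel w s y z = noiseKernel w (r * s) x z := by
    intro z
    simp only [noiseKernel, ← Finset.prod_mul_distrib]
    rw [sum_prod_apply fun j b => (r j * (if x j = b then 1 else 0) + (1 - r j) * w b) *
      (s j * (if b = z j then 1 else 0) + (1 - s j) * w (z j))]
    refine Finset.prod_congr rfl fun j _ => ?_
    have h1 : ∀ b, (r j * (if x j = b then 1 else 0) + (1 - r j) * w b) *
        (s j * (if b = z j then 1 else 0) + (1 - s j) * w (z j)) =
        (if x j = b then r j * s j * (if b = z j then 1 else 0) else 0) +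
        (if x j = b then r j * (1 - s j) * w (z j) else 0) +
        (if b = z j then (1 - r j) * s j * w b else 0) +
        (1 - r j) * (1 - s j) * w (z j) * w b := by
      intro b
      split_ifs <;> ring
    simp only [h1, Finset.sum_add_distrib, ← Finset.mul_sum, hw1, Finset.sum_ite_eq,
      Finset.sum_ite_eq', Finset.mem_univ, if_true, Pi.mul_apply]
    ring
  simp only [noise, Finset.mul_sum, ← h, Finset.sum_mul]
  rw [Finset.sum_comm]
  simp only [mul_assoc]

theorem mean_noise (hw1 : ∑ b, w b = 1) (r : Fin n → ℝ) (f : (Fin n → α) → ℝ) :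
    mean w (noise w r f) = mean w f := by
  by_cases h : Nonempty (Fin n → α)
  · obtain ⟨x⟩ := h
    rw [← noise_zero _ x, noise_noise hw1, zero_mul, noise_zero]
  · rw [not_nonempty_iff] at h
    simp [mean]

theorem mean_add (f g : (Fin n → α) → ℝ) : mean w (f + g) = mean w f + mean w g := by
  simp [mean, mul_add, Finset.sum_add_distrib]

theorem mean_sub (f g : (Fin n → α) → ℝ) : mean w (f - g) = mean w f - mean w g := by
  simp [mean, mul_sub, Finset.sum_sub_distrib]

theorem mean_smul (c : ℝ) (f : (Fin n → α) → ℝ) : mean w (c • f) = c * mean w f := by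
  simp [mean, Finset.mul_sum, mul_left_comm]

theorem mean_sum {ι : Type*} (s : Finset ι) (f : ι → (Fin n → α) → ℝ) :
    mean w (∑ i ∈ s, f i) = ∑ i ∈ s, mean w (f i) := by
  simp only [mean, Finset.sum_apply, Finset.mul_sum]
  rw [Finset.sum_comm]

theorem mean_const (hw1 : ∑ b, w b = 1) (c : ℝ) : mean (n := n) w (fun _ => c) = c := by
  simp only [mean, ← Finset.sum_mul]
  rw [sum_prod_apply fun _ => w]
  simp [hw1]

theorem mean_mono (hw : ∀ b, 0 < w b) {f g : (Fin n → α) → ℝ} (h : ∀ x, f x ≤ g x) :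
    mean w f ≤ mean w g :=
  Finset.sum_le_sum fun x _ =>
    mul_le_mul_of_nonneg_left (h x) (Finset.prod_nonneg fun _ _ => (hw _).le)

theorem mean_nonneg (hw : ∀ b, 0 < w b) {f : (Fin n → α) → ℝ} (h : ∀ x, 0 ≤ f x) :
    0 ≤ mean w f :=
  Finset.sum_nonneg fun x _ => mul_nonneg (Finset.prod_nonneg fun _ _ => (hw _).le) (h x)

theorem mean_pos (hw : ∀ b, 0 < w b) {f : (Fin n → α) → ℝ} (h : ∀ x, 0 ≤ f x)
    {x : Fin n → α} (hx : 0 < f x) : 0 < mean w f := by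
  refine Finset.sum_pos' (fun x _ => mul_nonneg (Finset.prod_nonneg fun _ _ => (hw _).le) (h x))
    ⟨x, Finset.mem_univ _, mul_pos (Finset.prod_pos fun _ _ => hw _) hx⟩

theorem mean_mul_noise (r : Fin n → ℝ) (f g : (Fin n → α) → ℝ) :
    mean w (f * noise w r g) = mean w (noise w r f * g) := by
  -- Detailed balance: the kernel is reversible for the product weight.
  have h : ∀ x y, (∏ j, w (x j)) * noiseKernel w r x y =
      (∏ j, w (y j)) * noiseKernel w r y x := by
    intro x y
    simp only [noiseKernel, ← Finset.prod_mul_distrib]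
    refine Finset.prod_congr rfl fun j _ => ?_
    by_cases hj : x j = y j
    · simp [hj]
    · simp [hj, Ne.symm hj]; ring
  simp only [mean, noise, Pi.mul_apply, Finset.mul_sum, Finset.sum_mul]
  rw [Finset.sum_comm]
  refine Finset.sum_congr rfl fun y _ => Finset.sum_congr rfl fun x _ => ?_
  linear_combination f x * g y * h x y

theorem mean_noise_mul_noise (hw1 : ∑ b, w b = 1) (r s : Fin n → ℝ) (f g : (Fin n → α) → ℝ) :
    mean w (noise w r f * noise w s g) = mean w (f * noise w (r * s) g) := by
  rw [← noise_noise hw1, mean_mul_noise r]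

theorem noiseKernel_nonneg (hw : ∀ b, 0 < w b) {r : Fin n → ℝ} (h0 : ∀ j, 0 ≤ r j)
    (h1 : ∀ j, r j ≤ 1) (x y : Fin n → α) : 0 ≤ noiseKernel w r x y := by
  refine Finset.prod_nonneg fun j _ => add_nonneg (mul_nonneg (h0 j) ?_)
    (mul_nonneg (sub_nonneg.2 (h1 j)) (hw _).le)
  split_ifs <;> norm_num

theorem noiseKernel_self_pos (hw : ∀ b, 0 < w b) {r : Fin n → ℝ} (h0 : ∀ j, 0 ≤ r j)
    (h1 : ∀ j, r j ≤ 1) (x : Fin n → α) : 0 < noiseKernel w r x x := by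
  refine Finset.prod_pos fun j _ => ?_
  rcases (h0 j).eq_or_lt with h | h
  · simp [← h, hw]
  · have := mul_nonneg (sub_nonneg.2 (h1 j)) (hw (x j)).le
    simp; linarith

theorem noise_nonneg (hw : ∀ b, 0 < w b) {r : Fin n → ℝ} (h0 : ∀ j, 0 ≤ r j)
    (h1 : ∀ j, r j ≤ 1) {f : (Fin n → α) → ℝ} (h : ∀ x, 0 ≤ f x) (x : Fin n → α) :
    0 ≤ noise w r f x :=
  Finset.sum_nonneg fun y _ => mul_nonneg (noiseKernel_nonneg hw h0 h1 x y) (h y)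

theorem noise_pos (hw : ∀ b, 0 < w b) {r : Fin n → ℝ} (h0 : ∀ j, 0 ≤ r j)
    (h1 : ∀ j, r j ≤ 1) {f : (Fin n → α) → ℝ} (h : ∀ x, 0 ≤ f x) {x : Fin n → α}
    (hx : 0 < f x) : 0 < noise w r f x :=
  Finset.sum_pos' (fun y _ => mul_nonneg (noiseKernel_nonneg hw h0 h1 x y) (h y))
    ⟨x, Finset.mem_univ _, mul_pos (noiseKernel_self_pos hw h0 h1 x) hx⟩

theorem abs_noise_le (hw : ∀ b, 0 < w b) {r : Fin n → ℝ} (h0 : ∀ j, 0 ≤ r j)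
    (h1 : ∀ j, r j ≤ 1) (f : (Fin n → α) → ℝ) (x : Fin n → α) :
    |noise w r f x| ≤ noise w r (fun y => |f y|) x := by
  refine (Finset.abs_sum_le_sum_abs _ _).trans (Finset.sum_le_sum fun y _ => ?_)
  rw [abs_mul, abs_of_nonneg (noiseKernel_nonneg hw h0 h1 x y)]

theorem mean_abs_noise_le (hw : ∀ b, 0 < w b) (hw1 : ∑ b, w b = 1) {r : Fin n → ℝ}
    (h0 : ∀ j, 0 ≤ r j) (h1 : ∀ j, r j ≤ 1) (f : (Fin n → α) → ℝ) :
    mean w (fun x => |noise w r f x|) ≤ mean w (fun x => |f x|) :=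
  (mean_mono hw (abs_noise_le hw h0 h1 f)).trans_eq (mean_noise hw1 _ _)

theorem noise_sq_le (hw : ∀ b, 0 < w b) (hw1 : ∑ b, w b = 1) {r : Fin n → ℝ}
    (h0 : ∀ j, 0 ≤ r j) (h1 : ∀ j, r j ≤ 1) (f : (Fin n → α) → ℝ) (x : Fin n → α) :
    noise w r f x ^ 2 ≤ noise w r (f * f) x := by
  set c := noise w r f x with hc
  -- Jensen for squares: average `(f - c)² ≥ 0`, where `c` is the average at the fixed point `x`.
  have h := noise_nonneg hw h0 h1 (f := f * f - (2 * c) • f + fun _ => c ^ 2)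
    (fun y => by simp; nlinarith [sq_nonneg (f y - c)]) x
  rw [noise_add, noise_sub, noise_smul, noise_const hw1] at h
  simp only [Pi.add_apply, Pi.sub_apply, Pi.smul_apply, smul_eq_mul, ← hc] at h
  linarith

theorem mean_noise_sq_le (hw : ∀ b, 0 < w b) (hw1 : ∑ b, w b = 1) {r : Fin n → ℝ}
    (h0 : ∀ j, 0 ≤ r j) (h1 : ∀ j, r j ≤ 1) (f : (Fin n → α) → ℝ) :
    mean w (noise w r f * noise w r f) ≤ mean w (f * f) := by
  rw [← mean_noise hw1 r (f * f)]
  exact mean_mono hw fun x => by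
    simpa [sq] using noise_sq_le hw hw1 h0 h1 f x

/-- When every coordinate is either kept or resampled, functions in the range of the averaging
operator are constant along its kernel. -/
theorem noise_apply_eq_of_noiseKernel_ne_zero {r : Fin n → ℝ} (hr : ∀ j, r j = 0 ∨ r j = 1)
    {x y : Fin n → α} (h : noiseKernel w r x y ≠ 0) (f : (Fin n → α) → ℝ) :
    noise w r f y = noise w r f x := by
  have hxy : ∀ j, r j = 1 → x j = y j := by
    intro j hj
    have := Finset.prod_ne_zero_iff.1 h j (Finset.mem_univ _)
    by_contra hne
    simp [hj, hne] at this
  refine Finset.sum_congr rfl fun z _ => ?_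
  congr 1
  refine Finset.prod_congr rfl fun j _ => ?_
  rcases hr j with hj | hj
  · simp [hj]
  · rw [hxy j hj]

/-- For parameters in `{0, 1}` the operator is a conditional expectation, and measurable factors can
be pulled out. Two functions `a`, `b` are allowed so that quotients of conditional expectations are
covered. -/
theorem noise_mul_of_fixed {r : Fin n → ℝ} (hr : ∀ j, r j = 0 ∨ r j = 1)
    (F : ℝ → ℝ → ℝ) {a b : (Fin n → α) → ℝ} (ha : noise w r a = a) (hb : noise w r b = b)
    (c : (Fin n → α) → ℝ) :
    noise w r (fun x => F (a x) (b x) * c x) = fun x => F (a x) (b x) * noise w r c x := by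
  funext x
  simp only [noise, Finset.mul_sum]
  refine Finset.sum_congr rfl fun y _ => ?_
  by_cases h : noiseKernel w r x y = 0
  · simp [h]
  · rw [← ha, ← hb, noise_apply_eq_of_noiseKernel_ne_zero hr h,
      noise_apply_eq_of_noiseKernel_ne_zero hr h]
    ring

end Noise

/-! ### Tensorized entropy and the Nash inequality -/

section Entropy

variable {α : Type*} [Fintype α] [DecidableEq α] {n : ℕ} {w : α → ℝ}

/-- The parameter for which `noise` averages over the `k`-th coordinate alone. -/
noncomputable def resample (k : Fin n) : Fin n → ℝ := fun i => if i = k then 0 else 1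

/-- The parameter for which `noise` averages over the first `k` coordinates. -/
noncomputable def tail (n k : ℕ) : Fin n → ℝ := fun i => if i.val < k then 0 else 1

theorem resample_eq_zero_or_one (k j : Fin n) : resample k j = 0 ∨ resample k j = 1 := by
  unfold resample; split_ifs <;> simp

theorem tail_eq_zero_or_one (k : ℕ) (j : Fin n) : tail n k j = 0 ∨ tail n k j = 1 := by
  unfold tail; split_ifs <;> simp

theorem nonneg_of_eq_zero_or_one {r : Fin n → ℝ} (hr : ∀ j, r j = 0 ∨ r j = 1) (j : Fin n) :
    0 ≤ r j := by rcases hr j with h | h <;> simp [h]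

theorem le_one_of_eq_zero_or_one {r : Fin n → ℝ} (hr : ∀ j, r j = 0 ∨ r j = 1) (j : Fin n) :
    r j ≤ 1 := by rcases hr j with h | h <;> simp [h]

theorem mul_self_of_eq_zero_or_one {r : Fin n → ℝ} (hr : ∀ j, r j = 0 ∨ r j = 1) : r * r = r := by
  funext j; rcases hr j with h | h <;> simp [h]

theorem tail_zero : tail n 0 = 1 := by
  funext i; simp [tail]

theorem tail_self : tail n n = 0 := by
  funext i; simp [tail]

theorem tail_mul_resample (k : Fin n) : tail n k * resample k = tail n (k + 1) := by
  funext i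
  simp only [tail, resample, Pi.mul_apply, Fin.ext_iff]
  split_ifs <;> first | omega | simp

theorem tail_mul_tail_succ (k : ℕ) : tail n k * tail n (k + 1) = tail n (k + 1) := by
  funext i
  simp only [tail, Pi.mul_apply]
  split_ifs <;> first | omega | simp

theorem noise_resample (k : Fin n) (f : (Fin n → α) → ℝ) (x : Fin n → α) :
    noise w (resample k) f x = ∑ b, w b * f (Function.update x k b) := by
  have h : ∀ y, noiseKernel w (resample k) x y =
      ∑ b, if y = Function.update x k b then w b else 0 := by
    intro y
    by_cases hy : y = Function.update x k (y k)
    · have h1 : ∀ b, y = Function.update x k b ↔ y k = b := by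
        intro b
        constructor
        · intro h; rw [h]; simp
        · rintro rfl; exact hy
      simp only [h1, Finset.sum_ite_eq, Finset.mem_univ, if_true, noiseKernel]
      rw [Finset.prod_eq_single k]
      · simp [resample]
      · intro j _ hj
        have : y j = x j := by rw [hy]; simp [hj]
        simp [resample, hj, this]
      · simp
    · have h1 : ∀ b, y ≠ Function.update x k b := by
        intro b hb
        apply hy
        have : y k = b := by rw [hb]; simp
        rw [this]; exact hb
      simp only [h1, if_false, Finset.sum_const_zero, noiseKernel]
      obtain ⟨j, hj⟩ := Function.ne_iff.1 hy
      by_cases hjk : j = k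
      · subst hjk; simp at hj
      · rw [Function.update_of_ne hjk] at hj
        exact Finset.prod_eq_zero (Finset.mem_univ j) (by simp [resample, hjk, Ne.symm hj])
  simp only [noise, h, Finset.sum_mul, ite_mul, zero_mul]
  rw [Finset.sum_comm]
  simp

/-- The Dirichlet form `∑ₖ 𝔼 |f - 𝔼ₖ f|²`. -/
noncomputable def energy (w : α → ℝ) (f : (Fin n → α) → ℝ) : ℝ :=
  ∑ k, mean w ((f - noise w (resample k) f) * (f - noise w (resample k) f))

theorem mean_sub_noise_mul_self (hw1 : ∑ b, w b = 1) {r : Fin n → ℝ} (hr : r * r = r)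
    (f : (Fin n → α) → ℝ) :
    mean w ((f - noise w r f) * (f - noise w r f)) =
      mean w (f * f) - mean w (noise w r f * noise w r f) := by
  have h := mean_noise_mul_noise hw1 r r f f
  rw [hr] at h
  have h2 : (f - noise w r f) * (f - noise w r f) =
      f * f - (2 : ℝ) • (f * noise w r f) + noise w r f * noise w r f := by
    funext x; simp; ring
  rw [h2, mean_add, mean_sub, mean_smul, h]
  ring

theorem energy_nonneg (hw : ∀ b, 0 < w b) (f : (Fin n → α) → ℝ) : 0 ≤ energy w f :=
  Finset.sum_nonneg fun _ _ => mean_nonneg hw fun _ => mul_self_nonneg _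

/-- Entropy along one coordinate is controlled by the variance along it. -/
theorem mean_mul_log_sub_log_noise_resample_le (hw : ∀ b, 0 < w b) (hw1 : ∑ b, w b = 1) {C : ℝ}
    (hC0 : 0 ≤ C)
    (hC : ∀ G : α → ℝ, ∑ b, w b * G b ^ 4 - (∑ b, w b * G b ^ 2) ^ 2 ≤
      C * (∑ b, w b * G b ^ 2) * (∑ b, w b * G b ^ 2 - (∑ b, w b * G b) ^ 2))
    (k : Fin n) (g : (Fin n → α) → ℝ) :
    mean w (fun x => (g * g) x *
        (Real.log ((g * g) x) - Real.log (noise w (resample k) (g * g) x))) ≤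
      C * mean w ((g - noise w (resample k) g) * (g - noise w (resample k) g)) := by
  have hr := resample_eq_zero_or_one k
  have h0 := nonneg_of_eq_zero_or_one hr
  have h1 := le_one_of_eq_zero_or_one hr
  have hrr := mul_self_of_eq_zero_or_one hr
  set h := g * g with hh
  have hpos : ∀ x, 0 ≤ h x := fun x => mul_self_nonneg _
  set E := noise w (resample k) with hE
  have hEpos : ∀ x, 0 ≤ E h x := noise_nonneg hw h0 h1 hpos
  have hEE : E (E h) = E h := by rw [hE, noise_noise hw1, hrr]
  -- Entropy is at most chi-square: `log t ≤ t - 1` at `t = h / E h`.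
  have step1 : mean w (fun x => h x * (Real.log (h x) - Real.log (E h x))) ≤
      mean w ((fun x => (E h x)⁻¹ * (h * h) x) - h) := by
    refine mean_mono hw fun x => ?_
    rcases (hpos x).eq_or_lt with hx | hx
    · simp [← hx]
    · have hEx : 0 < E h x := noise_pos hw h0 h1 hpos hx
      have := Real.log_le_sub_one_of_pos (div_pos hx hEx)
      rw [Real.log_div hx.ne' hEx.ne'] at this
      have := mul_le_mul_of_nonneg_left this hx.le
      refine this.trans_eq ?_
      simp only [Pi.sub_apply, Pi.mul_apply]
      field_simp
  have step2 : mean w (fun x => (E h x)⁻¹ * (h * h) x) =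
      mean w (fun x => (E h x)⁻¹ * E (h * h) x) := by
    rw [← mean_noise hw1 (resample k)]
    exact congrArg _ (noise_mul_of_fixed hr (fun a _ => a⁻¹) hEE hEE (h * h))
  have step3 : mean w (fun x => (E h x)⁻¹ * E (h * h) x) ≤
      mean w (E h + C • (E h - E g * E g)) := by
    refine mean_mono hw fun x => ?_
    -- The hypothesis `hC` on the one-coordinate section of `g` through `x`.
    have key : E (h * h) x - E h x ^ 2 ≤ C * E h x * (E h x - E g x ^ 2) := by
      have := hC fun b => g (Function.update x k b)
      simp only [hE, noise_resample, hh, Pi.mul_apply]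
      convert this using 6 <;> ring
    have hvar : E g x ^ 2 ≤ E h x := noise_sq_le hw hw1 h0 h1 g x
    simp only [Pi.add_apply, Pi.smul_apply, Pi.sub_apply, Pi.mul_apply, smul_eq_mul]
    rcases (hEpos x).eq_or_lt with hx | hx
    · rw [← hx]
      have : E g x * E g x ≤ 0 := by rw [hx]; nlinarith
      simp; nlinarith
    · rw [inv_mul_le_iff₀ hx]
      nlinarith
  rw [mean_sub, step2] at step1
  rw [mean_add, mean_smul, mean_sub, hE, mean_noise hw1] at step3
  rw [mean_sub_noise_mul_self hw1 hrr]
  linarith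

/-- Resampling the first coordinates decreases the relative entropy along the next one. -/
theorem mean_mul_log_tail_le (hw : ∀ b, 0 < w b) (hw1 : ∑ b, w b = 1) (k : Fin n)
    {h : (Fin n → α) → ℝ} (hpos : ∀ x, 0 ≤ h x) :
    mean w (fun x => h x * (Real.log (noise w (tail n k) h x) -
        Real.log (noise w (tail n (k + 1)) h x))) ≤
      mean w (fun x => h x * (Real.log (h x) - Real.log (noise w (resample k) h x))) := by
  have hr := resample_eq_zero_or_one k
  have hr0 := nonneg_of_eq_zero_or_one hr
  have hr1 := le_one_of_eq_zero_or_one hr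
  have ht := tail_eq_zero_or_one (n := n) k
  have ht0 := nonneg_of_eq_zero_or_one ht
  have ht1 := le_one_of_eq_zero_or_one ht
  have hs := tail_eq_zero_or_one (n := n) (k + 1)
  have hs0 := nonneg_of_eq_zero_or_one hs
  have hs1 := le_one_of_eq_zero_or_one hs
  set A := noise w (tail n k) h with hA
  set B := noise w (tail n (k + 1)) h with hB
  set E := noise w (resample k) h with hE
  have hA0 : ∀ x, 0 ≤ A x := noise_nonneg hw ht0 ht1 hpos
  have hB0 : ∀ x, 0 ≤ B x := noise_nonneg hw hs0 hs1 hpos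
  have hE0 : ∀ x, 0 ≤ E x := noise_nonneg hw hr0 hr1 hpos
  have hAA : noise w (tail n k) A = A := by
    rw [hA, noise_noise hw1, mul_self_of_eq_zero_or_one ht]
  have hAB : noise w (tail n k) B = B := by
    rw [hB, noise_noise hw1, tail_mul_tail_succ]
  have hAE : noise w (tail n k) E = B := by
    rw [hE, noise_noise hw1, tail_mul_resample]
  -- Averaging over the first `k` coordinates fixes `A` and `B` and turns `E` into `B`, so the
  -- integrand becomes `A` where `B ≠ 0`, and `0` where `B = 0`.
  have step1 : mean w (fun x => A x / B x * E x) ≤ mean w h := by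
    rw [← mean_noise hw1 (tail n k), ← mean_noise hw1 (tail n k) h,
      noise_mul_of_fixed ht (fun a b => a / b) hAA hAB, hAE, ← hA]
    refine mean_mono hw fun x => ?_
    rcases eq_or_ne (B x) 0 with hx | hx
    · simp [hx, hA0 x]
    · simp [hx]
  -- `log t ≤ t - 1` at `t = A E / (B h)`, multiplied by `h`.
  have step2 : mean w ((fun x => h x * (Real.log (A x) - Real.log (B x))) -
      fun x => h x * (Real.log (h x) - Real.log (E x))) ≤
      mean w ((fun x => A x / B x * E x) - h) := by
    refine mean_mono hw fun x => ?_
    simp only [Pi.sub_apply]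
    rcases (hpos x).eq_or_lt with hx | hx
    · have := mul_nonneg (div_nonneg (hA0 x) (hB0 x)) (hE0 x)
      simpa [← hx] using this
    · have hAx : 0 < A x := noise_pos hw ht0 ht1 hpos hx
      have hBx : 0 < B x := noise_pos hw hs0 hs1 hpos hx
      have hEx : 0 < E x := noise_pos hw hr0 hr1 hpos hx
      have := Real.log_le_sub_one_of_pos (div_pos (mul_pos (div_pos hAx hBx) hEx) hx)
      rw [Real.log_div (by positivity) hx.ne', Real.log_mul (by positivity) hEx.ne',
        Real.log_div hAx.ne' hBx.ne'] at this
      have := mul_le_mul_of_nonneg_left this hx.le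
      have h3 : h x * (A x / B x * E x / h x - 1) = A x / B x * E x - h x := by
        field_simp
      linarith
  rw [mean_sub, mean_sub] at step2
  linarith

theorem entropy_le_energy (hw : ∀ b, 0 < w b) (hw1 : ∑ b, w b = 1) {C : ℝ}
    (hC0 : 0 ≤ C)
    (hC : ∀ G : α → ℝ, ∑ b, w b * G b ^ 4 - (∑ b, w b * G b ^ 2) ^ 2 ≤
      C * (∑ b, w b * G b ^ 2) * (∑ b, w b * G b ^ 2 - (∑ b, w b * G b) ^ 2))
    (g : (Fin n → α) → ℝ) :
    mean w (fun x => (g * g) x * (Real.log ((g * g) x) - Real.log (mean w (g * g)))) ≤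
      C * energy w g := by
  set h := g * g with hh
  -- Chain rule for entropy: telescope along averages over initial segments, from `h` down to its
  -- mean.
  have htel : (fun x => h x * (Real.log (h x) - Real.log (mean w h))) =
      ∑ k : Fin n, fun x => h x * (Real.log (noise w (tail n k) h x) -
        Real.log (noise w (tail n (k + 1)) h x)) := by
    funext x
    rw [Finset.sum_apply, ← Finset.mul_sum,
      Fin.sum_univ_eq_sum_range (fun k => Real.log (noise w (tail n k) h x) -
        Real.log (noise w (tail n (k + 1)) h x)) n, Finset.sum_range_sub', tail_zero, tail_self,
      noise_one, noise_zero]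
  rw [htel, mean_sum, energy, Finset.mul_sum]
  exact Finset.sum_le_sum fun k _ =>
    (mean_mul_log_tail_le hw hw1 k fun x => mul_self_nonneg _).trans
      (mean_mul_log_sub_log_noise_resample_le hw hw1 hC0 hC k g)

/-- A Nash-type inequality: a function whose `L¹` norm is much smaller than its `L²` norm has
large energy. -/
theorem nash_le_energy (hw : ∀ b, 0 < w b) (hw1 : ∑ b, w b = 1) {C : ℝ}
    (hC0 : 0 ≤ C)
    (hC : ∀ G : α → ℝ, ∑ b, w b * G b ^ 4 - (∑ b, w b * G b ^ 2) ^ 2 ≤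
      C * (∑ b, w b * G b ^ 2) * (∑ b, w b * G b ^ 2 - (∑ b, w b * G b) ^ 2))
    (g : (Fin n → α) → ℝ) :
    mean w (g * g) * (Real.log (mean w (g * g)) - 2 * Real.log (mean w fun x => |g x|)) ≤
      C * energy w g := by
  refine le_trans ?_ (entropy_le_energy hw hw1 hC0 hC g)
  set N := mean w (g * g) with hN
  set M := mean w (fun x => |g x|) with hM
  have hM0 : 0 ≤ M := mean_nonneg hw fun _ => abs_nonneg _
  have hN0 : 0 ≤ N := mean_nonneg hw fun _ => mul_self_nonneg _
  by_cases hg : ∀ x, g x = 0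
  · have : g = 0 := funext hg
    have h1 : N = 0 := by rw [hN, this]; simp [mean]
    rw [h1]
    simp [this, mean]
  push Not at hg
  obtain ⟨z, hz⟩ := hg
  have hMp : 0 < M := mean_pos hw (fun _ => abs_nonneg _) (abs_pos.2 hz)
  have hNp : 0 < N := mean_pos hw (fun _ => mul_self_nonneg _) (mul_self_pos.2 hz)
  -- Jensen for `log` under the density `g² / N`, written as the tangent-line bound `log t ≤ t - 1`
  -- at `t = N / (M |g|)`. The right-hand side has mean `2N - 2N = 0`.
  have key : mean w ((2 * Real.log (N / M) - Real.log N) • (g * g) -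
      (fun x => (g * g) x * (Real.log ((g * g) x) - Real.log N))) ≤
      mean w ((2 * (N / M)) • (fun x => |g x|) - (2 : ℝ) • (g * g)) := by
    refine mean_mono hw fun x => ?_
    simp only [Pi.sub_apply, Pi.smul_apply, smul_eq_mul, Pi.mul_apply]
    by_cases hx : g x = 0
    · simp [hx]
    · have hax := abs_pos.2 hx
      have := Real.log_le_sub_one_of_pos (div_pos (div_pos hNp hMp) hax)
      rw [Real.log_div (by positivity) hax.ne', Real.log_abs] at this
      have h2 := mul_le_mul_of_nonneg_left this (mul_self_nonneg (g x))
      have h3 : g x * g x * (N / M / |g x| - 1) = N / M * |g x| - g x * g x := by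
        rw [← abs_mul_abs_self (g x)]; field_simp
      rw [h3] at h2
      rw [Real.log_mul hx hx]
      linarith
  rw [mean_sub, mean_sub, mean_smul, mean_smul, mean_smul, ← hN, ← hM, 
    Real.log_div hNp.ne' hMp.ne'] at key
  have h4 : 2 * (N / M) * M = 2 * N := by field_simp
  rw [h4] at key
  linarith

end Entropy

/-! ### Martingale decomposition and the Falik–Samorodnitsky inequality -/

section Martingale

variable {α : Type*} [Fintype α] [DecidableEq α] {n : ℕ} {w : α → ℝ}

theorem noise_comm (hw1 : ∑ b, w b = 1) (r s : Fin n → ℝ) (f : (Fin n → α) → ℝ) :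
    noise w r (noise w s f) = noise w s (noise w r f) := by
  rw [noise_noise hw1, noise_noise hw1, mul_comm]

/-- The difference of the averages of `f` over the first `k` and the first `k + 1` coordinates. -/
noncomputable def martingaleDiff (w : α → ℝ) (k : Fin n) (f : (Fin n → α) → ℝ) :
    (Fin n → α) → ℝ :=
  noise w (tail n k) f - noise w (tail n (k + 1)) f

theorem martingaleDiff_eq (hw1 : ∑ b, w b = 1) (k : Fin n) (f : (Fin n → α) → ℝ) :
    martingaleDiff w k f = noise w (tail n k) (f - noise w (resample k) f) := by
  rw [martingaleDiff, noise_sub, noise_noise hw1, tail_mul_resample]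

theorem mean_martingaleDiff_mul_self (hw1 : ∑ b, w b = 1) (k : Fin n) (f : (Fin n → α) → ℝ) :
    mean w (martingaleDiff w k f * martingaleDiff w k f) =
      mean w (noise w (tail n k) f * noise w (tail n k) f) -
      mean w (noise w (tail n (k + 1)) f * noise w (tail n (k + 1)) f) := by
  have hs := mul_self_of_eq_zero_or_one (tail_eq_zero_or_one (n := n) (k + 1))
  have h : noise w (tail n (k + 1)) f =
      noise w (tail n (k + 1)) (noise w (tail n k) f) := by
    rw [noise_noise hw1, mul_comm, tail_mul_tail_succ]
  rw [martingaleDiff, h]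
  exact mean_sub_noise_mul_self hw1 hs _

theorem sum_mean_martingaleDiff_mul_self (hw1 : ∑ b, w b = 1) (f : (Fin n → α) → ℝ) :
    ∑ k, mean w (martingaleDiff w k f * martingaleDiff w k f) =
      mean w (f * f) - mean w f ^ 2 := by
  simp only [mean_martingaleDiff_mul_self hw1]
  rw [Fin.sum_univ_eq_sum_range (fun k =>
    mean w (noise w (tail n k) f * noise w (tail n k) f) -
      mean w (noise w (tail n (k + 1)) f * noise w (tail n (k + 1)) f)) n,
    Finset.sum_range_sub', tail_zero, tail_self, noise_one]
  congr 1
  have : noise w 0 f * noise w 0 f = fun _ => mean w f ^ 2 := by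
    funext x; simp [noise_zero, sq]
  rw [this, mean_const hw1]

/-- Since `I - E_j` commutes with the martingale decomposition, for each `j` the sum over `k` is the
variance of `f - E_j f`, which is at most its second moment. -/
theorem sum_energy_martingaleDiff_le (hw1 : ∑ b, w b = 1)
    (f : (Fin n → α) → ℝ) :
    ∑ k, energy w (martingaleDiff w k f) ≤ energy w f := by
  simp only [energy]
  rw [Finset.sum_comm]
  refine Finset.sum_le_sum fun j _ => ?_
  have h : ∀ k, martingaleDiff w k f - noise w (resample j) (martingaleDiff w k f) =
      martingaleDiff w k (f - noise w (resample j) f) := by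
    intro k
    simp only [martingaleDiff, noise_sub, noise_comm hw1 (resample j)]
    abel
  simp only [h, sum_mean_martingaleDiff_mul_self hw1]
  linarith [sq_nonneg (mean w (f - noise w (resample j) f))]

theorem variance_le_energy (hw : ∀ b, 0 < w b) (hw1 : ∑ b, w b = 1) (f : (Fin n → α) → ℝ) :
    mean w (f * f) - mean w f ^ 2 ≤ energy w f := by
  rw [← sum_mean_martingaleDiff_mul_self hw1, energy]
  refine Finset.sum_le_sum fun k _ => ?_
  rw [martingaleDiff_eq hw1]
  have ht := tail_eq_zero_or_one (n := n) k
  exact mean_noise_sq_le hw hw1 (nonneg_of_eq_zero_or_one ht) (le_one_of_eq_zero_or_one ht) _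

/-- Apply the Nash inequality to each martingale difference: its `L¹` norm is at most `β k`, and the
second moments `a k` sum to `v`. The log-sum inequality then combines the terms. -/
theorem mul_log_variance_sub_log_sum_sq_le_energy (hw : ∀ b, 0 < w b) (hw1 : ∑ b, w b = 1) {C : ℝ}
    (hC0 : 0 ≤ C)
    (hC : ∀ G : α → ℝ, ∑ b, w b * G b ^ 4 - (∑ b, w b * G b ^ 2) ^ 2 ≤
      C * (∑ b, w b * G b ^ 2) * (∑ b, w b * G b ^ 2 - (∑ b, w b * G b) ^ 2))
    (g : (Fin n → α) → ℝ) (β : Fin n → ℝ)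
    (hβ : ∀ k, mean w (fun x => |(g - noise w (resample k) g) x|) ≤ β k)
    {v : ℝ} (hv : v = mean w (g * g) - mean w g ^ 2) (hv0 : 0 < v)
    (hW : 0 < ∑ k, β k ^ 2) :
    v * (Real.log v - Real.log (∑ k, β k ^ 2)) ≤ C * energy w g := by
  set W := ∑ k, β k ^ 2 with hWdef
  set d := fun k => martingaleDiff w k g with hd
  set a := fun k => mean w (d k * d k) with ha
  have hsum : ∑ k, a k = v := by rw [hv, ← sum_mean_martingaleDiff_mul_self hw1]
  have hL1 : ∀ k, mean w (fun x => |d k x|) ≤ β k := by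
    intro k
    refine le_trans ?_ (hβ k)
    simp only [hd, martingaleDiff_eq hw1]
    have ht := tail_eq_zero_or_one (n := n) k
    exact mean_abs_noise_le hw hw1 (nonneg_of_eq_zero_or_one ht) (le_one_of_eq_zero_or_one ht) _
  -- Log-sum inequality, term by term: the correction `β k ^ 2 * v / W - a k` sums to `v - v = 0`.
  have key : ∀ k, a k * (Real.log v - Real.log W) - (β k ^ 2 * v / W - a k) ≤
      C * energy w (d k) := by
    intro k
    refine le_trans ?_ (nash_le_energy hw hw1 hC0 hC (d k))
    change _ ≤ a k * (Real.log (a k) - _)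
    have ha0 : 0 ≤ a k := mean_nonneg hw fun _ => mul_self_nonneg _
    rcases ha0.eq_or_lt with h | h
    · rw [← h]
      have : 0 ≤ β k ^ 2 * v / W := by positivity
      linarith
    · have hM : 0 < mean w (fun x => |d k x|) := by
        by_contra hcon
        have hz : ∀ x, d k x = 0 := by
          intro x
          by_contra hx
          exact hcon (mean_pos hw (fun _ => abs_nonneg _) (abs_pos.2 hx))
        have : a k = 0 := by simp [ha, mean, hz]
        exact h.ne' this
      have hβp : 0 < β k := hM.trans_le (hL1 k)
      have hlog := Real.log_le_log hM (hL1 k)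
      have h1 := Real.log_le_sub_one_of_pos (x := β k ^ 2 * v / W / a k) (by positivity)
      rw [Real.log_div (by positivity) h.ne', Real.log_div (by positivity) hW.ne',
        Real.log_mul (by positivity) hv0.ne', Real.log_pow] at h1
      have h2 := mul_le_mul_of_nonneg_left h1 ha0
      have h3 : a k * (β k ^ 2 * v / W / a k - 1) = β k ^ 2 * v / W - a k := by field_simp
      rw [h3] at h2
      have h4 := mul_le_mul_of_nonneg_left hlog ha0
      push_cast at h2
      linarith
  have htot := Finset.sum_le_sum fun k (_ : k ∈ Finset.univ) => key k
  rw [Finset.sum_sub_distrib, Finset.sum_sub_distrib, ← Finset.sum_mul, ← Finset.mul_sum,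
    ← Finset.sum_div, ← Finset.sum_mul, hsum, ← hWdef, mul_div_assoc, mul_div_cancel₀ _ hW.ne'] at htot
  have := mul_le_mul_of_nonneg_left (sum_energy_martingaleDiff_le hw1 g) hC0
  linarith

/-- The Nash inequality for the centered function. It later compensates for the term `log v` above,
which is harmful when the variance is small. -/
theorem mul_log_variance_sub_log_mean_abs_le_energy (hw : ∀ b, 0 < w b) (hw1 : ∑ b, w b = 1)
    {C : ℝ} (hC0 : 0 ≤ C)
    (hC : ∀ G : α → ℝ, ∑ b, w b * G b ^ 4 - (∑ b, w b * G b ^ 2) ^ 2 ≤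
      C * (∑ b, w b * G b ^ 2) * (∑ b, w b * G b ^ 2 - (∑ b, w b * G b) ^ 2))
    (g : (Fin n → α) → ℝ) :
    (mean w (g * g) - mean w g ^ 2) * (Real.log (mean w (g * g) - mean w g ^ 2) -
      2 * Real.log (mean w fun x => |g x - mean w g|)) ≤ C * energy w g := by
  have h := nash_le_energy hw hw1 hC0 hC (g - fun _ => mean w g)
  have h1 : mean w ((g - fun _ => mean w g) * (g - fun _ => mean w g)) =
      mean w (g * g) - mean w g ^ 2 := by
    have : (g - fun _ => mean w g) * (g - fun _ => mean w g) =
        g * g - (2 * mean w g) • g + fun _ => mean w g ^ 2 := by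
      funext x; simp; ring
    rw [this, mean_add, mean_sub, mean_smul, mean_const hw1]
    ring
  have h2 : energy w (g - fun _ => mean w g) = energy w g := by
    simp only [energy, noise_sub, noise_const hw1, sub_sub_sub_cancel_right]
  rw [h1, h2] at h
  exact h

end Martingale

/-! ### Differentiation in the noise parameter and the reverse Poincaré inequality -/

section Semigroup

variable {α : Type*} [Fintype α] [DecidableEq α] {n : ℕ} {w : α → ℝ}

theorem noiseKernel_sub_noiseKernel_resample (r : Fin n → ℝ) (j : Fin n) (x y : Fin n → α) :
    noiseKernel w r x y - noiseKernel w (resample j * r) x y =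
      (∏ i ∈ Finset.univ.erase j, (r i * (if x i = y i then 1 else 0) + (1 - r i) * w (y i))) *
        (r j * ((if x j = y j then 1 else 0) - w (y j))) := by
  have h : noiseKernel w (resample j * r) x y =
      (∏ i ∈ Finset.univ.erase j, (r i * (if x i = y i then 1 else 0) + (1 - r i) * w (y i))) *
        w (y j) := by
    rw [noiseKernel, ← Finset.prod_erase_mul _ _ (Finset.mem_univ j)]
    congr 1
    · refine Finset.prod_congr rfl fun i hi => ?_
      simp [resample, Finset.ne_of_mem_erase hi]
    · simp [resample]
  rw [h, noiseKernel, ← Finset.prod_erase_mul _ _ (Finset.mem_univ j)]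
  ring

/-- Product rule: differentiating the `j`-th factor of the kernel gives `ρ⁻¹` times the effect of `I
- E_j`. -/
theorem hasDerivAt_noise_const (hw1 : ∑ b, w b = 1) (f : (Fin n → α) → ℝ) (x : Fin n → α) {ρ : ℝ}
    (hρ : ρ ≠ 0) :
    HasDerivAt (fun ρ => noise w (fun _ => ρ) f x)
      (ρ⁻¹ * ∑ j, (noise w (fun _ => ρ) f - noise w (resample j) (noise w (fun _ => ρ) f)) x)
      ρ := by
  have hk : ∀ y, HasDerivAt (fun ρ => noiseKernel w (fun _ => ρ) x y)
      (ρ⁻¹ * ∑ j, (noiseKernel w (fun _ => ρ) x y -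
        noiseKernel w (resample j * fun _ => ρ) x y)) ρ := by
    intro y
    have h1 : ∀ j : Fin n, HasDerivAt
        (fun ρ : ℝ => ρ * (if x j = y j then (1 : ℝ) else 0) + (1 - ρ) * w (y j))
        ((if x j = y j then (1 : ℝ) else 0) - w (y j)) ρ := by
      intro j
      have := ((hasDerivAt_id ρ).mul_const (if x j = y j then (1 : ℝ) else 0)).add
        (((hasDerivAt_id ρ).const_sub 1).mul_const (w (y j)))
      refine HasDerivAt.congr_deriv this (Eq.symm ?_)
      ring
    have h2 := HasDerivAt.fun_finsetProd (u := Finset.univ) fun j _ => h1 j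
    refine HasDerivAt.congr_deriv h2 (Eq.symm ?_)
    simp only [noiseKernel_sub_noiseKernel_resample, Finset.mul_sum, smul_eq_mul]
    refine Finset.sum_congr rfl fun j _ => ?_
    field_simp
  have h3 := HasDerivAt.fun_sum (u := Finset.univ) fun y _ => (hk y).mul_const (f y)
  refine HasDerivAt.congr_deriv h3 (Eq.symm ?_)
  simp only [Pi.sub_apply, noise_noise hw1]
  simp only [noise, Finset.mul_sum, Finset.sum_mul, ← Finset.sum_sub_distrib]
  rw [Finset.sum_comm]
  refine Finset.sum_congr rfl fun j _ => Finset.sum_congr rfl fun y _ => ?_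
  ring

theorem mean_mul_sub_noise (hw1 : ∑ b, w b = 1) {r : Fin n → ℝ} (hr : r * r = r)
    (f u : (Fin n → α) → ℝ) :
    mean w (f * (u - noise w r u)) = mean w ((f - noise w r f) * (u - noise w r u)) := by
  have h := mean_noise_mul_noise hw1 r r f u
  rw [hr] at h
  have h2 := mean_mul_noise (w := w) r f u
  rw [sub_mul, mean_sub (f * _), mul_sub (noise w r f), mean_sub (noise w r f * u), h, ← h2]
  ring

theorem const_sqrt_mul_const_sqrt {ρ : ℝ} (hρ : 0 ≤ ρ) :
    (fun _ : Fin n => √ρ) * (fun _ => √ρ) = fun _ => ρ := by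
  funext i; simp [Real.mul_self_sqrt hρ]

theorem mean_mul_noise_const (hw1 : ∑ b, w b = 1) (f : (Fin n → α) → ℝ) {ρ : ℝ} (hρ : 0 ≤ ρ) :
    mean w (f * noise w (fun _ => ρ) f) =
      mean w (noise w (fun _ => √ρ) f * noise w (fun _ => √ρ) f) := by
  rw [mean_noise_mul_noise hw1, const_sqrt_mul_const_sqrt hρ]

theorem sum_mean_mul_sub_noise (hw1 : ∑ b, w b = 1) (f : (Fin n → α) → ℝ) {ρ : ℝ} (hρ : 0 ≤ ρ) :
    ∑ j, mean w (f * (noise w (fun _ => ρ) f -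
      noise w (resample j) (noise w (fun _ => ρ) f))) = energy w (noise w (fun _ => √ρ) f) := by
  refine Finset.sum_congr rfl fun j _ => ?_
  have hr := mul_self_of_eq_zero_or_one (resample_eq_zero_or_one j)
  rw [mean_sub_noise_mul_self hw1 hr, mean_noise_mul_noise hw1 (resample j), hr, mul_sub, mean_sub,
    mean_mul_noise_const hw1 f hρ, noise_noise hw1 (resample j) (fun _ => √ρ),
    mean_noise_mul_noise hw1 (fun _ => √ρ) (resample j * fun _ => √ρ), noise_noise hw1,
    mul_left_comm, const_sqrt_mul_const_sqrt hρ]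

theorem hasDerivAt_mean_mul_noise_const (hw1 : ∑ b, w b = 1) (f : (Fin n → α) → ℝ) {ρ : ℝ}
    (hρ : ρ ≠ 0) :
    HasDerivAt (fun ρ => mean w (f * noise w (fun _ => ρ) f))
      (ρ⁻¹ * ∑ j, mean w (f * (noise w (fun _ => ρ) f -
        noise w (resample j) (noise w (fun _ => ρ) f)))) ρ := by
  have h := HasDerivAt.fun_sum (u := Finset.univ) fun y _ =>
    ((hasDerivAt_noise_const hw1 f y hρ).const_mul (f y)).const_mul (∏ j, w (y j))
  refine HasDerivAt.congr_deriv h (Eq.symm ?_)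
  simp only [mean, Finset.mul_sum]
  rw [Finset.sum_comm]
  refine Finset.sum_congr rfl fun y _ => Finset.sum_congr rfl fun j _ => ?_
  simp only [Pi.mul_apply]
  ring

theorem sum_prod_mul_apply {q : Fin n → α → ℝ} (hq : ∀ i, ∑ b, q i b = 1) (i : Fin n)
    (F : α → ℝ) : ∑ y : Fin n → α, (∏ l, q l (y l)) * F (y i) = ∑ b, q i b * F b := by
  have h : ∀ y : Fin n → α, (∏ l, q l (y l)) * F (y i) =
      ∏ l, q l (y l) * (if l = i then F (y l) else 1) := by
    intro y
    rw [Finset.prod_mul_distrib, Finset.prod_ite_eq' Finset.univ i]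
    simp
  simp only [h]
  rw [sum_prod_apply fun l b => q l b * (if l = i then F b else 1), Finset.prod_eq_single i]
  · simp
  · intro l _ hl; simp [hl, hq]
  · simp

theorem sum_prod_mul_apply_mul_apply {q ψ : Fin n → α → ℝ} (hψ : ∀ i, ∑ b, q i b * ψ i b = 0)
    {i j : Fin n} (hij : i ≠ j) :
    ∑ y : Fin n → α, (∏ l, q l (y l)) * (ψ i (y i) * ψ j (y j)) = 0 := by
  have h : ∀ y : Fin n → α, (∏ l, q l (y l)) * (ψ i (y i) * ψ j (y j)) =
      ∏ l, q l (y l) * ((if l = i then ψ i (y l) else 1) * (if l = j then ψ j (y l) else 1)) := by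
    intro y
    rw [Finset.prod_mul_distrib, Finset.prod_mul_distrib, Finset.prod_ite_eq' Finset.univ i,
      Finset.prod_ite_eq' Finset.univ j]
    simp
  simp only [h]
  rw [sum_prod_apply fun l b =>
    q l b * ((if l = i then ψ i b else 1) * (if l = j then ψ j b else 1))]
  exact Finset.prod_eq_zero (Finset.mem_univ i) (by simp [hij, hψ])

/-- Bessel's inequality for centered functions of independent coordinates. -/
theorem sum_sq_le_of_centered {q ψ : Fin n → α → ℝ} (hq0 : ∀ i b, 0 ≤ q i b)
    (hq : ∀ i, ∑ b, q i b = 1) (hψ : ∀ i, ∑ b, q i b * ψ i b = 0) {M : ℝ} (hM0 : 0 < M)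
    (hM : ∀ i, ∑ b, q i b * ψ i b ^ 2 ≤ M) (f : (Fin n → α) → ℝ) :
    ∑ i, (∑ y, (∏ l, q l (y l)) * (ψ i (y i) * f y)) ^ 2 ≤
      M * ∑ y, (∏ l, q l (y l)) * f y ^ 2 := by
  set c := fun i => ∑ y, (∏ l, q l (y l)) * (ψ i (y i) * f y) with hc
  set S := ∑ i, c i ^ 2 with hS
  change S ≤ _
  set F := ∑ y, (∏ l, q l (y l)) * f y ^ 2 with hF
  set Z := fun y : Fin n → α => ∑ i, c i * ψ i (y i) with hZ
  have h1 : ∑ y, (∏ l, q l (y l)) * (f y * Z y) = S := by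
    simp only [hZ, hS, Finset.mul_sum]
    rw [Finset.sum_comm]
    refine Finset.sum_congr rfl fun i _ => ?_
    rw [sq]
    nth_rw 2 [hc]
    rw [Finset.mul_sum]
    exact Finset.sum_congr rfl fun y _ => by ring
  have h2 : ∑ y, (∏ l, q l (y l)) * Z y ^ 2 ≤ M * S := by
    have : ∀ y, (∏ l, q l (y l)) * Z y ^ 2 =
        ∑ i, ∑ j, c i * c j * ((∏ l, q l (y l)) * (ψ i (y i) * ψ j (y j))) := by
      intro y
      rw [sq, hZ, Finset.sum_mul_sum, Finset.mul_sum]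
      refine Finset.sum_congr rfl fun i _ => ?_
      rw [Finset.mul_sum]
      exact Finset.sum_congr rfl fun j _ => by ring
    simp only [this]
    rw [Finset.sum_comm, hS, Finset.mul_sum]
    refine Finset.sum_le_sum fun i _ => ?_
    rw [Finset.sum_comm, Finset.sum_eq_single i]
    · rw [← Finset.mul_sum]
      have h3 := sum_prod_mul_apply hq i fun b => ψ i b ^ 2
      simp only [sq] at h3 ⊢
      rw [h3, mul_comm M]
      refine mul_le_mul_of_nonneg_left ?_ (mul_self_nonneg _)
      simpa only [sq] using hM i
    · intro j _ hj
      rw [← Finset.mul_sum, sum_prod_mul_apply_mul_apply hψ hj.symm, mul_zero]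
    · simp
  have h3 : 0 ≤ ∑ y, (∏ l, q l (y l)) * (f y - M⁻¹ * Z y) ^ 2 :=
    Finset.sum_nonneg fun y _ => mul_nonneg (Finset.prod_nonneg fun _ _ => hq0 _ _) (sq_nonneg _)
  have h4 : ∑ y, (∏ l, q l (y l)) * (f y - M⁻¹ * Z y) ^ 2 =
      -- Both cross terms equal `S`, and the last sum is at most `M * S` by independence, so
      -- nonnegativity of the square gives `S ≤ M * F`.
      F - 2 * M⁻¹ * S + M⁻¹ ^ 2 * ∑ y, (∏ l, q l (y l)) * Z y ^ 2 := by
    rw [← h1, hF, Finset.mul_sum, Finset.mul_sum, ← Finset.sum_sub_distrib,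
      ← Finset.sum_add_distrib]
    exact Finset.sum_congr rfl fun y _ => by ring
  have h5 := mul_le_mul_of_nonneg_left h2 (sq_nonneg M⁻¹)
  have h6 : M⁻¹ ^ 2 * (M * S) = M⁻¹ * S := by field_simp
  have h7 : M⁻¹ * S ≤ F := by linarith
  rwa [inv_mul_le_iff₀ hM0] at h7

/-- The reverse Poincaré inequality. -/
theorem sum_sub_noise_resample_sq_le (hw : ∀ b, 0 < w b) (hw1 : ∑ b, w b = 1)
    (f : (Fin n → α) → ℝ) {ρ : ℝ} (h0 : 0 ≤ ρ) (h1 : ρ < 1) (x : Fin n → α) :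
    ∑ j, (noise w (fun _ => ρ) f - noise w (resample j) (noise w (fun _ => ρ) f)) x ^ 2 ≤
      (∑ b, (w b)⁻¹) / (1 - ρ) * noise w (fun _ => ρ) (fun y => f y ^ 2) x := by
  have hρ : 0 < 1 - ρ := sub_pos.2 h1
  set q := fun (i : Fin n) (b : α) => ρ * (if x i = b then 1 else 0) + (1 - ρ) * w b with hq
  have hqw : ∀ i b, (1 - ρ) * w b ≤ q i b := by
    intro i b
    have : 0 ≤ ρ * (if x i = b then (1 : ℝ) else 0) :=
      mul_nonneg h0 (by split_ifs <;> norm_num)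
    simp only [hq]; linarith
  have hqpos : ∀ i b, 0 < q i b := fun i b => (mul_pos hρ (hw b)).trans_le (hqw i b)
  -- The law of the noisy copy of `x` is the product of the `q i`. Relative to it, `I - E_i` acts as
  -- multiplication by the centered score `ψ i (y i)`; Bessel's inequality applies, and `q ≥ (1 - ρ)
  -- w` bounds the second moments.
  set ψ := fun (i : Fin n) (b : α) => ρ * ((if x i = b then 1 else 0) - w b) / q i b with hψ
  have hqψ : ∀ i b, q i b * ψ i b = ρ * ((if x i = b then 1 else 0) - w b) := by
    intro i b
    exact mul_div_cancel₀ _ (hqpos i b).ne'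
  have hwle : ∀ b, w b ≤ 1 := fun b =>
    hw1 ▸ Finset.single_le_sum (fun b _ => (hw b).le) (Finset.mem_univ b)
  have hne : Nonempty α := by
    by_contra h
    rw [not_nonempty_iff] at h
    simp at hw1
  have hMpos : 0 < (∑ b, (w b)⁻¹) / (1 - ρ) :=
    div_pos (Finset.sum_pos (fun b _ => inv_pos.2 (hw b)) Finset.univ_nonempty) hρ
  have key := sum_sq_le_of_centered (q := q) (ψ := ψ) (fun i b => (hqpos i b).le)
    (fun i => by simp [hq, Finset.sum_add_distrib, ← Finset.mul_sum, hw1])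
    (fun i => by simp only [hqψ]; simp [← Finset.mul_sum, hw1])
    hMpos (fun i => by
      rw [Finset.sum_div]
      refine Finset.sum_le_sum fun b _ => ?_
      have e : q i b * ψ i b ^ 2 = (ρ * ((if x i = b then 1 else 0) - w b)) ^ 2 / q i b := by
        have := (hqpos i b).ne'
        simp only [hψ]
        field_simp
      rw [e, inv_eq_one_div, div_div, mul_comm (w b)]
      refine div_le_div₀ zero_le_one ?_ (mul_pos hρ (hw b)) (hqw i b)
      rw [sq_le_one_iff_abs_le_one, abs_mul, abs_of_nonneg h0]
      refine mul_le_one₀ h1.le (abs_nonneg _) ?_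
      have := hw b
      have := hwle b
      rw [abs_le]
      split_ifs <;> constructor <;> linarith) f
  refine le_trans (le_of_eq ?_) key
  refine Finset.sum_congr rfl fun j _ => ?_
  congr 1
  rw [noise_noise hw1, Pi.sub_apply]
  simp only [noise]
  rw [← Finset.sum_sub_distrib]
  refine Finset.sum_congr rfl fun y _ => ?_
  rw [← sub_mul, noiseKernel_sub_noiseKernel_resample, ← hqψ, ← mul_assoc (∏ l, q l (y l)),
    ← Finset.prod_erase_mul _ _ (Finset.mem_univ j), mul_assoc (∏ _ ∈ _, _) (q j (y j))]

end Semigroup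

/-! ### Comparing the two derivative bounds -/

theorem mul_sqrt_le_of_deriv_bounds {φ φ' : ℝ → ℝ} {V L K κ : ℝ} (hV : 0 ≤ V) (hL : 0 ≤ L)
    (hK : 0 ≤ K) (hκ1 : κ ≤ 1)
    (hφ : ∀ ρ, 0 < ρ → HasDerivAt φ (φ' ρ) ρ)
    (hpos : ∀ ρ, 0 < ρ → ρ < 1 → 0 ≤ φ' ρ)
    (hupper : ∀ ρ, 0 < ρ → ρ < 1 → φ' ρ ≤ ρ⁻¹ * (K / √(1 - ρ)))
    (hlower : ∀ ρ, 0 < ρ → ρ < 1 → φ 1 - V / 2 ≤ φ ρ → φ ρ ≤ φ 1 → κ * V * (1 + L) ≤ φ' ρ) :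
    κ * V * √L ≤ 8 * K := by
  -- The lower bound on `φ'` over an interval of this length forces a drop of `κ * V / 2`, and `t ≤
  -- 1 / 2` keeps `ρ⁻¹ ≤ 2`.
  set t := 1 / (2 * (1 + L)) with ht
  have ht0 : 0 < t := by positivity
  have ht1 : t ≤ 1 / 2 := by
    rw [ht]; apply one_div_le_one_div_of_le <;> linarith
  have htL : t * (1 + L) = 1 / 2 := by rw [ht]; field_simp
  set ρ₀ := 1 - t with hρ₀
  have hρ₀' : 1 / 2 ≤ ρ₀ := by linarith
  have hcont : ContinuousOn φ (Set.Icc ρ₀ 1) := fun ρ hρ =>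
    (hφ ρ (by linarith [hρ.1])).continuousAt.continuousWithinAt
  have hmono : MonotoneOn φ (Set.Icc ρ₀ 1) := by
    refine monotoneOn_of_deriv_nonneg (convex_Icc _ _) hcont ?_ ?_
    · intro ρ hρ
      rw [interior_Icc] at hρ
      exact (hφ ρ (by linarith [hρ.1])).differentiableAt.differentiableWithinAt
    · intro ρ hρ
      rw [interior_Icc] at hρ
      rw [(hφ ρ (by linarith [hρ.1])).deriv]
      exact hpos ρ (by linarith [hρ.1]) hρ.2
  have hle : ρ₀ ≤ 1 := by linarith
  have hlow : κ * V / 2 ≤ φ 1 - φ ρ₀ := by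
    -- Either the lower bound holds on all of `[ρ₀, 1]`, by monotonicity, or `φ` has already dropped
    -- by more than `V / 2`.
    by_cases hcase : φ 1 - V / 2 ≤ φ ρ₀
    · obtain ⟨c, hc, hceq⟩ := exists_hasDerivAt_eq_slope φ φ' (by linarith : ρ₀ < 1) hcont
        fun ρ hρ => hφ ρ (by linarith [hρ.1])
      have hc' : c ∈ Set.Icc ρ₀ 1 := ⟨hc.1.le, hc.2.le⟩
      have h1 := hlower c (by linarith [hc.1]) hc.2
        (hcase.trans (hmono ⟨le_rfl, hle⟩ hc' hc.1.le)) (hmono hc' ⟨hle, le_rfl⟩ hc.2.le)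
      rw [hceq, le_div_iff₀ (by linarith)] at h1
      have : κ * V * (1 + L) * (1 - ρ₀) = κ * V / 2 := by
        rw [hρ₀]; linear_combination κ * V * htL
      linarith
    · have := mul_le_mul_of_nonneg_right hκ1 hV
      linarith
  have hsq : ∀ ρ, 0 < ρ → ρ < 1 →
      HasDerivAt (fun ρ => φ ρ + 4 * K * √(1 - ρ)) (φ' ρ + 4 * K * (-1 / (2 * √(1 - ρ)))) ρ := by
    intro ρ h0 h1
    exact (hφ ρ h0).add ((((hasDerivAt_id ρ).const_sub 1).sqrt (by simp; linarith)).const_mul _)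
  -- The added term is an antiderivative of `-2 * K / √(1 - ρ)`, so this integrates the upper bound
  -- up to the singularity at `1`.
  have hanti : AntitoneOn (fun ρ => φ ρ + 4 * K * √(1 - ρ)) (Set.Icc ρ₀ 1) := by
    refine antitoneOn_of_deriv_nonpos (convex_Icc _ _) (hcont.add (by fun_prop)) ?_ ?_
    · intro ρ hρ
      rw [interior_Icc] at hρ
      exact (hsq ρ (by linarith [hρ.1]) hρ.2).differentiableAt.differentiableWithinAt
    · intro ρ hρ
      rw [interior_Icc] at hρ
      have hρ0 : 0 < ρ := by linarith [hρ.1]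
      rw [(hsq ρ hρ0 hρ.2).deriv]
      have h1 := hupper ρ hρ0 hρ.2
      have h2 : ρ⁻¹ ≤ 2 := by
        rw [inv_le_comm₀ hρ0 two_pos]; linarith [hρ.1]
      have h3 : 0 < √(1 - ρ) := Real.sqrt_pos.2 (by linarith [hρ.2])
      have h4 := mul_le_mul_of_nonneg_right h2 (div_nonneg hK h3.le)
      have h5 : 4 * K * (-1 / (2 * √(1 - ρ))) = -(2 * (K / √(1 - ρ))) := by field_simp; ring
      linarith
  have hup := hanti ⟨le_rfl, hle⟩ ⟨hle, le_rfl⟩ hle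
  simp only [sub_self, Real.sqrt_zero, mul_zero, add_zero, hρ₀, sub_sub_cancel] at hup
  rw [← hρ₀] at hup
  have h1 : κ * V / 2 ≤ 4 * K * √t := by linarith
  have h2 := mul_le_mul_of_nonneg_right h1 (Real.sqrt_nonneg L)
  have h3 : √t * √L ≤ 1 := by
    rw [← Real.sqrt_mul ht0.le, Real.sqrt_le_one]
    nlinarith
  have h4 := mul_le_mul_of_nonneg_left h3 (mul_nonneg (by norm_num : (0:ℝ) ≤ 4) hK)
  linarith

theorem log_one_add_exp_div_le {W : ℝ} (hW : 0 < W) :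
    Real.log (1 + Real.exp 1 / W) ≤ 2 + max 0 (-Real.log W) := by
  have he := Real.exp_pos 1
  have he2 : 1 + Real.exp 1 ≤ Real.exp 2 := by
    have : Real.exp 2 = Real.exp 1 * Real.exp 1 := by rw [← Real.exp_add]; norm_num
    have := Real.add_one_le_exp (1 : ℝ)
    nlinarith
  have hlog : Real.log (1 + Real.exp 1) ≤ 2 := by
    rw [Real.log_le_iff_le_exp (by positivity)]; exact he2
  rcases le_total W 1 with h | h
  · have h1 : 1 + Real.exp 1 / W ≤ (1 + Real.exp 1) / W := by
      rw [add_div]; gcongr; rwa [one_le_div hW]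
    have h2 := Real.log_le_log (by positivity) h1
    rw [Real.log_div (by positivity) hW.ne'] at h2
    have := le_max_right 0 (-Real.log W)
    linarith
  · have h1 : 1 + Real.exp 1 / W ≤ 1 + Real.exp 1 := by
      gcongr; exact div_le_self he.le h
    have h2 := Real.log_le_log (by positivity) h1
    have := le_max_left 0 (-Real.log W)
    linarith

/-! ### Boolean functions on a product space -/

section Boolean

variable {α : Type*} [Fintype α] [DecidableEq α] {n : ℕ} {w : α → ℝ}

/-- For `f = ±1` with mean `m`, `|f - m| = 1 - m f`. Thus the `L¹` norm of `f - m` is the variance.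
-/
theorem mean_abs_sub_mean_of_boolean (hw : ∀ b, 0 < w b) (hw1 : ∑ b, w b = 1)
    {f : (Fin n → α) → ℝ} (hf : ∀ x, f x = -1 ∨ f x = 1) :
    mean w (fun x => |f x - mean w f|) = 1 - mean w f ^ 2 := by
  have hle : mean w f ≤ 1 := by
    rw [← mean_const (n := n) hw1 1]
    exact mean_mono hw fun x => by rcases hf x with h | h <;> norm_num [h]
  have hge : -1 ≤ mean w f := by
    rw [← mean_const (n := n) hw1 (-1)]
    exact mean_mono hw fun x => by rcases hf x with h | h <;> rw [h]; norm_num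
  have : (fun x => |f x - mean w f|) = (fun _ => 1) - mean w f • f := by
    funext x
    rcases hf x with h | h
    · simp only [Pi.sub_apply, Pi.smul_apply, smul_eq_mul, h]
      rw [abs_of_nonpos] <;> linarith
    · simp only [Pi.sub_apply, Pi.smul_apply, smul_eq_mul, h]
      rw [abs_of_nonneg] <;> linarith
  rw [this, mean_sub, mean_smul, mean_const hw1]
  ring

theorem sum_mean_mul_sub_noise_le (hw : ∀ b, 0 < w b) (hw1 : ∑ b, w b = 1)
    {f : (Fin n → α) → ℝ} (hf : ∀ x, f x = -1 ∨ f x = 1) {ρ : ℝ} (h0 : 0 ≤ ρ) (h1 : ρ < 1) :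
    ∑ j, mean w (f * (noise w (fun _ => ρ) f - noise w (resample j) (noise w (fun _ => ρ) f))) ≤
      √(∑ b, (w b)⁻¹) * mean w (fun x => √(∑ j, (f - noise w (resample j) f) x ^ 2)) /
        √(1 - ρ) := by
  set u := noise w (fun _ => ρ) f with hu
  have h : ∀ j, mean w (f * (u - noise w (resample j) u)) =
      mean w ((f - noise w (resample j) f) * (u - noise w (resample j) u)) := fun j =>
    mean_mul_sub_noise hw1 (mul_self_of_eq_zero_or_one (resample_eq_zero_or_one j)) f u
  simp only [h]
  rw [← mean_sum, mul_div_right_comm, ← mean_smul]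
  refine mean_mono hw fun x => ?_
  have hone : noise w (fun _ => ρ) (fun y => f y ^ 2) x = 1 := by
    have : (fun y => f y ^ 2) = fun _ => 1 := by
      funext y; rcases hf y with h | h <;> rw [h] <;> norm_num
    rw [this, noise_const hw1]
  have hb := sum_sub_noise_resample_sq_le hw hw1 f h0 h1 x
  rw [hone, mul_one, ← hu] at hb
  have hcs := Real.sum_mul_le_sqrt_mul_sqrt Finset.univ
    (fun j => (f - noise w (resample j) f) x) (fun j => (u - noise w (resample j) u) x)
  simp only [Finset.sum_apply, Pi.mul_apply, Pi.smul_apply, smul_eq_mul]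
  refine hcs.trans ?_
  rw [mul_comm, ← Real.sqrt_div' _ (by linarith)]
  exact mul_le_mul_of_nonneg_right (Real.sqrt_le_sqrt hb) (Real.sqrt_nonneg _)

/-- Add the martingale bound `v (log v - log W)` to the centered Nash bound `v (log v - 2 log V)`.
As `log v ≥ log V - 1`, the variance logarithms cancel up to `-2`; the Poincaré bound `v ≤ energy`
absorbs the constants. -/
theorem mul_one_add_log_le_energy (hw : ∀ b, 0 < w b) (hw1 : ∑ b, w b = 1) {C : ℝ}
    (hC0 : 0 ≤ C)
    (hC : ∀ G : α → ℝ, ∑ b, w b * G b ^ 4 - (∑ b, w b * G b ^ 2) ^ 2 ≤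
      C * (∑ b, w b * G b ^ 2) * (∑ b, w b * G b ^ 2 - (∑ b, w b * G b) ^ 2))
    {f : (Fin n → α) → ℝ} (hf : ∀ x, f x = -1 ∨ f x = 1)
    (hV : 0 < 1 - mean w f ^ 2)
    (hW : 0 < ∑ j, mean w (fun x => |(f - noise w (resample j) f) x|) ^ 2)
    {r : ℝ} (h0 : 0 ≤ r) (h1 : r ≤ 1)
    (hv : (1 - mean w f ^ 2) / 2 ≤
      mean w (noise w (fun _ => r) f * noise w (fun _ => r) f) - mean w f ^ 2) :
    (1 - mean w f ^ 2) / 2 * (1 + Real.log (1 + Real.exp 1 /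
      ∑ j, mean w (fun x => |(f - noise w (resample j) f) x|) ^ 2)) ≤
      (2 * C + 5) * energy w (noise w (fun _ => r) f) := by
  set W := ∑ j, mean w (fun x => |(f - noise w (resample j) f) x|) ^ 2 with hWdef
  set V := 1 - mean w f ^ 2 with hVdef
  set g := noise w (fun _ => r) f with hg
  have hmg : mean w g = mean w f := mean_noise hw1 _ _
  rw [← hmg] at hv
  set v := mean w (g * g) - mean w g ^ 2 with hvdef
  have hv0 : 0 < v := by linarith
  have hE := energy_nonneg hw g
  have e1 : v ≤ energy w g := variance_le_energy hw hw1 g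
  have e2 := mul_log_variance_sub_log_sum_sq_le_energy hw hw1 hC0 hC g
    (fun j => mean w (fun x => |(f - noise w (resample j) f) x|)) (fun k => by
      rw [hg, noise_comm hw1, ← noise_sub]
      exact mean_abs_noise_le hw hw1 (fun _ => h0) (fun _ => h1) _) hvdef hv0 hW
  rw [← hWdef] at e2
  have e3 := mul_log_variance_sub_log_mean_abs_le_energy hw hw1 hC0 hC g
  rw [← hvdef] at e3
  have hM : mean w (fun x => |g x - mean w g|) ≤ V := by
    rw [hVdef, ← mean_abs_sub_mean_of_boolean hw hw1 hf]
    refine le_trans (le_of_eq ?_)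
      (mean_abs_noise_le hw hw1 (r := fun _ => r) (fun _ => h0) (fun _ => h1)
        (f - fun _ => mean w f))
    rw [noise_sub, noise_const hw1, hmg]
    rfl
  have hlogM : Real.log (mean w (fun x => |g x - mean w g|)) ≤ Real.log V := by
    have hM0 : 0 < mean w (fun x => |g x - mean w g|) := by
      by_contra hcon
      have hz : ∀ x, g x = mean w g := by
        intro x
        by_contra hx
        exact hcon (mean_pos hw (fun _ => abs_nonneg _) (abs_pos.2 (sub_ne_zero.2 hx)))
      have : g * g = fun _ => mean w g ^ 2 := by
        funext x; rw [Pi.mul_apply, hz x, sq]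
      rw [this, mean_const hw1, sub_self] at hvdef
      exact hv0.ne' hvdef
    exact Real.log_le_log hM0 hM
  have hlogv : Real.log V - 1 ≤ Real.log v := by
    have := Real.log_le_log (by positivity) hv
    rw [Real.log_div hV.ne' two_ne_zero] at this
    have := Real.log_two_lt_d9
    linarith
  have hL := log_one_add_exp_div_le hW
  set L := Real.log (1 + Real.exp 1 / W) with hLdef
  have hL0 : 0 ≤ L := Real.log_nonneg (by
    have : 0 ≤ Real.exp 1 / W := by positivity
    linarith)
  have key : v * (1 + L) ≤ (2 * C + 5) * energy w g := by
    rcases max_cases 0 (-Real.log W) with ⟨h, _⟩ | ⟨h, _⟩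
    · rw [h] at hL
      have := mul_le_mul_of_nonneg_left hL hv0.le
      nlinarith [mul_nonneg hC0 hE]
    · rw [h] at hL
      have a1 := mul_le_mul_of_nonneg_left hL hv0.le
      have a2 := mul_le_mul_of_nonneg_left hlogM hv0.le
      have a3 := mul_le_mul_of_nonneg_left hlogv hv0.le
      nlinarith
  have := mul_le_mul_of_nonneg_right hv (by linarith : 0 ≤ 1 + L)
  linarith

/-- The Eldan–Gross inequality for a product of finite probability spaces. -/
theorem eldanGross (hw : ∀ b, 0 < w b) (hw1 : ∑ b, w b = 1) {C : ℝ}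
    (hC0 : 0 ≤ C)
    (hC : ∀ G : α → ℝ, ∑ b, w b * G b ^ 4 - (∑ b, w b * G b ^ 2) ^ 2 ≤
      C * (∑ b, w b * G b ^ 2) * (∑ b, w b * G b ^ 2 - (∑ b, w b * G b) ^ 2))
    {f : (Fin n → α) → ℝ} (hf : ∀ x, f x = -1 ∨ f x = 1) :
    1 / (4 * C + 10) * (1 - mean w f ^ 2) * √(Real.log (1 + Real.exp 1 /
      ∑ j, mean w (fun x => |(f - noise w (resample j) f) x|) ^ 2)) ≤
      8 * (√(∑ b, (w b)⁻¹) * mean w (fun x => √(∑ j, (f - noise w (resample j) f) x ^ 2))) := by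
  set K := √(∑ b, (w b)⁻¹) * mean w (fun x => √(∑ j, (f - noise w (resample j) f) x ^ 2)) with hK
  have hK0 : 0 ≤ K := mul_nonneg (Real.sqrt_nonneg _) (mean_nonneg hw fun _ => Real.sqrt_nonneg _)
  set W := ∑ j, mean w (fun x => |(f - noise w (resample j) f) x|) ^ 2 with hWdef
  have hW0 : 0 ≤ W := Finset.sum_nonneg fun _ _ => sq_nonneg _
  have hV0 : 0 ≤ 1 - mean w f ^ 2 := by
    rw [← mean_abs_sub_mean_of_boolean hw hw1 hf]
    exact mean_nonneg hw fun _ => abs_nonneg _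
  rcases hW0.eq_or_lt with h | hW
  -- Division by zero gives `log (1 + 0) = 0`, the convention for constant `f`.
  · rw [← h]; simp [hK0]
  rcases hV0.eq_or_lt with h | hV
  · rw [← h]; simp [hK0]
  have hff : mean w (f * f) = 1 := by
    have : f * f = fun _ => 1 := by
      funext y; rcases hf y with h | h <;> simp [h]
    rw [this, mean_const hw1]
  have hφ1 : mean w (f * noise w (fun _ => 1) f) = 1 := by
    have : noise w (fun _ => 1) f = f := noise_one f
    rw [this, hff]
  refine mul_sqrt_le_of_deriv_bounds (φ := fun ρ => mean w (f * noise w (fun _ => ρ) f)) hV0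
    (Real.log_nonneg (by have : 0 ≤ Real.exp 1 / W := by positivity
                         linarith)) hK0
    (by rw [div_le_one (by positivity)]; linarith)
    (fun ρ hρ => hasDerivAt_mean_mul_noise_const hw1 f hρ.ne') ?_ ?_ ?_
  · intro ρ h0 _
    rw [sum_mean_mul_sub_noise hw1 f h0.le]
    exact mul_nonneg (inv_nonneg.2 h0.le) (energy_nonneg hw _)
  · intro ρ h0 h1
    exact mul_le_mul_of_nonneg_left (sum_mean_mul_sub_noise_le hw hw1 hf h0.le h1)
      (inv_nonneg.2 h0.le)
  · intro ρ h0 h1 hlo _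
    simp only [hφ1] at hlo
    rw [mean_mul_noise_const hw1 f h0.le] at hlo
    rw [sum_mean_mul_sub_noise hw1 f h0.le]
    have hE := mul_one_add_log_le_energy hw hw1 hC0 hC hf hV hW (Real.sqrt_nonneg ρ)
      (Real.sqrt_le_one.2 h1.le) (by linarith)
    rw [← hWdef] at hE
    have hinv : 1 ≤ ρ⁻¹ := (one_le_inv₀ h0).2 h1.le
    have h2 := mul_le_mul_of_nonneg_right hinv (energy_nonneg hw (noise w (fun _ => √ρ) f))
    refine le_trans ?_ (one_mul (energy w _) ▸ h2)
    rw [mul_assoc, one_div, inv_mul_le_iff₀ (by positivity)]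
    linarith

end Boolean

/-! ### The biased two-point space -/

section TwoPoint

/-- The point masses of `biasedMeasure`. -/
noncomputable def biasedWeight (p : ℝ) (b : ℤˣ) : ℝ := if b = 1 then p else 1 - p

theorem sum_units_int (F : ℤˣ → ℝ) : ∑ b, F b = F 1 + F (-1) := by
  have : (Finset.univ : Finset ℤˣ) = {1, -1} := by decide
  rw [this, Finset.sum_pair (by decide)]

variable {p : ℝ}

theorem biasedWeight_one : biasedWeight p 1 = p := by simp [biasedWeight]

theorem biasedWeight_neg_one : biasedWeight p (-1) = 1 - p := by
  have : (-1 : ℤˣ) ≠ 1 := by decide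
  simp [biasedWeight, this]

theorem biasedWeight_pos (hp0 : 0 < p) (hp1 : p < 1) (b : ℤˣ) : 0 < biasedWeight p b := by
  unfold biasedWeight; split_ifs <;> linarith

theorem sum_biasedWeight : ∑ b, biasedWeight p b = 1 := by
  rw [sum_units_int, biasedWeight_one, biasedWeight_neg_one]; ring

theorem biasedWeight_variance_sq_le (hp0 : 0 < p) (hp1 : p < 1) (G : ℤˣ → ℝ) :
    ∑ b, biasedWeight p b * G b ^ 4 - (∑ b, biasedWeight p b * G b ^ 2) ^ 2 ≤
      2 / (p * (1 - p)) * (∑ b, biasedWeight p b * G b ^ 2) *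
        (∑ b, biasedWeight p b * G b ^ 2 - (∑ b, biasedWeight p b * G b) ^ 2) := by
  simp only [sum_units_int, biasedWeight_one, biasedWeight_neg_one]
  set a := G 1
  set b := G (-1)
  have hq : 0 < 1 - p := by linarith
  have hpq : 0 < p * (1 - p) := by positivity
  have e1 : p * a ^ 4 + (1 - p) * b ^ 4 - (p * a ^ 2 + (1 - p) * b ^ 2) ^ 2 =
      p * (1 - p) * (a - b) ^ 2 * (a + b) ^ 2 := by ring
  have e2 : 2 / (p * (1 - p)) * (p * a ^ 2 + (1 - p) * b ^ 2) *
      (p * a ^ 2 + (1 - p) * b ^ 2 - (p * a + (1 - p) * b) ^ 2) =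
      p * (1 - p) * (a - b) ^ 2 * (2 * (a ^ 2 / (1 - p) + b ^ 2 / p)) := by
    field_simp; ring
  rw [e1, e2]
  have h1 : a ^ 2 ≤ a ^ 2 / (1 - p) := by
    rw [le_div_iff₀ hq]; nlinarith [sq_nonneg a]
  have h2 : b ^ 2 ≤ b ^ 2 / p := by
    rw [le_div_iff₀ hp0]; nlinarith [sq_nonneg b]
  refine mul_le_mul_of_nonneg_left ?_ (mul_nonneg hpq.le (sq_nonneg _))
  nlinarith [sq_nonneg (a - b)]

theorem isProbabilityMeasure_biasedMeasure (hp0 : 0 < p) (hp1 : p < 1) :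
    IsProbabilityMeasure (biasedMeasure p) := by
  constructor
  simp only [biasedMeasure, Measure.coe_add, Measure.coe_smul, Pi.add_apply, Pi.smul_apply,
    measure_univ, smul_eq_mul, mul_one]
  rw [← ENNReal.ofReal_add hp0.le (by linarith)]
  simp

theorem biasedMeasure_real_singleton (hp0 : 0 < p) (hp1 : p < 1) (b : ℤˣ) :
    (biasedMeasure p).real {b} = biasedWeight p b := by
  have h1 : (-1 : ℤˣ) ≠ 1 := by decide
  have hq : 0 ≤ 1 - p := by linarith
  rcases Int.units_eq_one_or b with rfl | rfl
  · rw [biasedWeight_one, Measure.real, biasedMeasure]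
    simp [h1, hp0.le]
  · rw [biasedWeight_neg_one, Measure.real, biasedMeasure]
    simp [h1.symm, hp1.le]

variable {n : ℕ}

theorem isProbabilityMeasure_cubeMeasure (hp0 : 0 < p) (hp1 : p < 1) :
    IsProbabilityMeasure (cubeMeasure p n) := by
  have := isProbabilityMeasure_biasedMeasure hp0 hp1
  unfold cubeMeasure
  infer_instance

theorem integral_cubeMeasure (hp0 : 0 < p) (hp1 : p < 1) (f : Cube n → ℝ) :
    ∫ x, f x ∂(cubeMeasure p n) = mean (biasedWeight p) f := by
  have := isProbabilityMeasure_cubeMeasure (n := n) hp0 hp1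
  rw [integral_fintype .of_finite]
  refine Finset.sum_congr rfl fun x _ => ?_
  rw [smul_eq_mul, cubeMeasure, Measure.real, Measure.pi_singleton, ENNReal.toReal_prod]
  congr 1
  exact Finset.prod_congr rfl fun j _ => biasedMeasure_real_singleton hp0 hp1 _

theorem partialExp_eq_noise (hp0 : 0 < p) (hp1 : p < 1) (j : Fin n) (f : Cube n → ℝ) :
    partialExp p j f = noise (biasedWeight p) (resample j) f := by
  funext x
  rw [partialExp, integral_fintype .of_finite, noise_resample]
  simp only [biasedMeasure_real_singleton hp0 hp1, smul_eq_mul]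

theorem influence_eq_mean (hp0 : 0 < p) (hp1 : p < 1) (j : Fin n) (f : Cube n → ℝ) :
    influence p j f =
      mean (biasedWeight p) fun x => |(f - noise (biasedWeight p) (resample j) f) x| := by
  rw [influence, integral_cubeMeasure hp0 hp1, partialExp_eq_noise hp0 hp1]
  rfl

theorem variance_eq_one_sub (hp0 : 0 < p) (hp1 : p < 1) {f : Cube n → ℝ}
    (hf : ∀ x, f x = -1 ∨ f x = 1) :
    variance f (cubeMeasure p n) = 1 - mean (biasedWeight p) f ^ 2 := by
  have := isProbabilityMeasure_cubeMeasure (n := n) hp0 hp1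
  rw [variance_eq_sub (.of_discrete)]
  have h : f ^ 2 = fun _ => 1 := by
    funext x; rcases hf x with h | h <;> simp [h]
  rw [h, integral_cubeMeasure hp0 hp1, integral_cubeMeasure hp0 hp1, mean_const sum_biasedWeight]

/-- `f - E_j f` is `2 D_j f` times the weight of the opposite sign, which is at most `1`. -/
theorem sub_noise_resample_sq_le (hp0 : 0 < p) (hp1 : p < 1) (j : Fin n) (f : Cube n → ℝ)
    (x : Cube n) :
    (f - noise (biasedWeight p) (resample j) f) x ^ 2 ≤ 4 * |discreteDeriv j f x| ^ 2 := by
  rw [Pi.sub_apply, noise_resample, sum_units_int, biasedWeight_one, biasedWeight_neg_one, sq_abs,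
    discreteDeriv, flip]
  have hx : f x = f (Function.update x j (x j)) := by rw [Function.update_eq_self]
  rw [hx]
  rcases Int.units_eq_one_or (x j) with h | h <;> rw [h]
  · set a := f (Function.update x j 1)
    set b := f (Function.update x j (-1))
    have h1 : (a - (p * a + (1 - p) * b)) ^ 2 = (1 - p) ^ 2 * (a - b) ^ 2 := by ring
    rw [h1]
    nlinarith [mul_nonneg (by nlinarith : 0 ≤ 1 - (1 - p) ^ 2) (sq_nonneg (a - b))]
  · rw [neg_neg]
    set a := f (Function.update x j 1)
    set b := f (Function.update x j (-1))
    have h1 : (b - (p * a + (1 - p) * b)) ^ 2 = p ^ 2 * (b - a) ^ 2 := by ring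
    rw [h1]
    nlinarith [mul_nonneg (by nlinarith : 0 ≤ 1 - p ^ 2) (sq_nonneg (b - a))]

theorem sqrt_sum_sub_noise_resample_sq_le (hp0 : 0 < p) (hp1 : p < 1) (f : Cube n → ℝ)
    (x : Cube n) :
    √(∑ j, (f - noise (biasedWeight p) (resample j) f) x ^ 2) ≤ 2 * gradNorm f x := by
  have h4 : (2 : ℝ) = √4 := by
    rw [show (4 : ℝ) = 2 ^ 2 by norm_num, Real.sqrt_sq two_pos.le]
  rw [gradNorm, h4, ← Real.sqrt_mul (by norm_num), Finset.mul_sum]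
  exact Real.sqrt_le_sqrt (Finset.sum_le_sum fun j _ => sub_noise_resample_sq_le hp0 hp1 j f x)

end TwoPoint

end BiasedCube

/-! ### The theorem on the biased cube -/

open BiasedCube in
theorem mainTheorem1 (p : ℝ) (hp0 : 0 < p) (hp1 : p < 1) :
    ∃ C : ℝ, 0 < C ∧ ∀ n : ℕ, 1 ≤ n → ∀ f : BiasedCube.Cube n → ℝ,
      (∀ x, f x = -1 ∨ f x = 1) →
        C * variance f (BiasedCube.cubeMeasure p n) *
            Real.sqrt (Real.log
              (1 + Real.exp 1 / ∑ j : Fin n, BiasedCube.influence p j f ^ 2)) ≤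
          ∫ x, BiasedCube.gradNorm f x ∂(BiasedCube.cubeMeasure p n) := by
  have hw := biasedWeight_pos hp0 hp1
  have hC0 : 0 ≤ 2 / (p * (1 - p)) := by
    have : 0 < 1 - p := by linarith
    positivity
  set C := 2 / (p * (1 - p))
  set M := √(∑ b, (biasedWeight p b)⁻¹) with hM
  have hM0 : 0 < M := Real.sqrt_pos.2
    (Finset.sum_pos (fun b _ => inv_pos.2 (hw b)) Finset.univ_nonempty)
  -- `16 = 8 * 2`: the factor `8` of `eldanGross` and the `2` lost in comparing gradients.
  refine ⟨1 / (4 * C + 10) / (16 * M), by positivity, fun n _ f hf => ?_⟩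
  have h := eldanGross hw sum_biasedWeight hC0 (biasedWeight_variance_sq_le hp0 hp1) hf
  have hgrad := mean_mono hw (g := (2 : ℝ) • gradNorm f)
    (sqrt_sum_sub_noise_resample_sq_le hp0 hp1 f)
  rw [mean_smul] at hgrad
  simp only [influence_eq_mean hp0 hp1, variance_eq_one_sub hp0 hp1 hf,
    integral_cubeMeasure hp0 hp1]
  rw [div_mul_eq_mul_div, div_mul_eq_mul_div, div_le_iff₀ (by positivity)]
  have := mul_le_mul_of_nonneg_left hgrad hM0.le
  rw [← hM] at h
  linarith
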